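/- Let $G$ be a group. For a normal subgroup $H \lhd G$, let $T_H := \{(g_1,g_2)\in G\times G \mid \psi(g_1)=\psi(g_2)\}\le G\times G$ be the associated fibre product, where $\psi : G\to G/H$ is the natural epimorphism. A group is residually finite if any two distinct elements have distinct images under some homomorphism to a finite group, and conjugacy separable if any two non-conjugate elements have non-conjugate images under some homomorphism to a finite group. A group is hyperbolic if it has a finite generating set whose Cayley graph is a Gromov hyperbolic space, i.e. there is $\delta\ge 0$ such that each side of every geodesic triangle lies in the $\delta$-neighbourhood of the union of the two other sides. Suppose that $G$ is a torsion-free residually finite hyperbolic group and that $H\lhd G$ is a finitely generated normal subgroup. If $G/H$ is not residually finite, then $T_H$ is not conjugacy separable. -/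

import Mathlib

/-- A walk in a graph is geodesic if its length equals the distance between its endpoints. -/
def SimpleGraph.Walk.IsGeodesicWalk {V : Type*} {Γ : SimpleGraph V} {x y : V}
    (p : Γ.Walk x y) : Prop :=
  p.length = Γ.dist x y

/-- All geodesic triangles of `Γ` are `δ`-slim: each side lies in the `δ`-neighbourhood of the union
of the two other sides. The triangles are the combinatorial ones (corners at vertices, sides
geodesic edge paths); for a connected graph, such a `δ` exists if and only if the geometric
realization of the graph, with its simplicial metric, is Gromov hyperbolic.
Since corners may be permuted and sides reversed, it is enough to speak about the side `p`. -/
def SimpleGraph.HasSlimTriangles {V : Type*} (Γ : SimpleGraph V) (δ : ℕ) : Prop :=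
  ∀ (x y z : V) (p : Γ.Walk x y) (q : Γ.Walk y z) (r : Γ.Walk x z),
    p.IsGeodesicWalk → q.IsGeodesicWalk → r.IsGeodesicWalk →
      ∀ u ∈ p.support, ∃ v, (v ∈ q.support ∨ v ∈ r.support) ∧ Γ.dist u v ≤ δ

/-- A group is (Gromov, word) hyperbolic if it has a finite generating set whose Cayley graph is a
Gromov hyperbolic space. (`SimpleGraph.mulCayley A` joins `g` to `g * a` for `a ∈ A ∪ A⁻¹`.) -/
def IsHyperbolicGroup (G : Type*) [Group G] : Prop :=
  ∃ A : Set G, A.Finite ∧ Subgroup.closure A = ⊤ ∧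
    ∃ δ : ℕ, (SimpleGraph.mulCayley A).HasSlimTriangles δ

/-- A group is torsion-free if its only element of finite order is the identity. (For
non-commutative groups `IsMulTorsionFree`, which asks for unique roots, is a stronger condition.) -/
def IsTorsionFreeGroup (G : Type*) [Group G] : Prop :=
  ∀ g : G, IsOfFinOrder g → g = 1

/-- A group is conjugacy separable if any two non-conjugate elements have non-conjugate images under
some homomorphism to a finite group. (Every finite group has a copy in `Type`.) -/
def IsConjugacySeparable (G : Type*) [Group G] : Prop :=
  ∀ x y : G, ¬ IsConj x y →
    ∃ (Q : Type) (_ : Group Q) (_ : Finite Q) (ψ : G →* Q), ¬ IsConj (ψ x) (ψ y)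

/-- The fibre product `{(g₁, g₂) | ψ g₁ = ψ g₂} ≤ G × G` of a normal subgroup `N` of `G`, where `ψ`
is the natural epimorphism from `G` to `G ⧸ N`. -/
def fibreProduct {G : Type*} [Group G] (N : Subgroup G) [N.Normal] : Subgroup (G × G) :=
  ((QuotientGroup.mk' N).comp (MonoidHom.fst G G)).eqLocus
    ((QuotientGroup.mk' N).comp (MonoidHom.snd G G))

/-! Suppose some `w ∈ H` has its whole centralizer inside `H`. As `G/H` is not residually finite,
some `g ∉ H` lies in every finite-index subgroup containing `H`. Then `(w, w)` and `(w, g w g⁻¹)`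
are not conjugate in the fibre product: a conjugator `(c₁, c₂)` has `c₁` and `g⁻¹ c₂` in the
centralizer of `w`, and `c₁⁻¹ c₂ ∈ H`, so `g ∈ H`. They are conjugate in every finite quotient,
because there `g` can be replaced by an element of `H` (`mem_of_isConjugacySeparable_fibreProduct`).

If `H` is abelian, it is trivial or of finite index (`finiteIndex_zpowers_of_forall_commute`), so
`G/H` is residually finite. Otherwise `w` is found as `x ^ n * y` with `x`, `y` powers or elements
of `H` that do not commute and `n` large (`exists_centralizer_le_zpowers`).

The geometry rests on the four-point inequality. Cyclic subgroups are undistorted, so every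
nontrivial element has an axial power. The centralizer of an axial element stays near its axis,
which makes commutation transitive (`commute_trans`), and an axis has bounded overlap with its
translate by a non-commuting element (`exists_forall_length_add_le_zpow`). -/

namespace SimpleGraph

/-! ### Slim triangles and the four-point condition. -/

variable {V : Type*} {Γ : SimpleGraph V}

theorem Walk.IsGeodesicWalk.dist_add_dist {x y u : V} {p : Γ.Walk x y} (hp : p.IsGeodesicWalk)
    (hΓ : Γ.Connected) (hu : u ∈ p.support) : Γ.dist x u + Γ.dist u y = Γ.dist x y := by
  classical
  have h1 := Γ.dist_le (p.takeUntil u hu)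
  have h2 := Γ.dist_le (p.dropUntil u hu)
  have h3 : (p.takeUntil u hu).length + (p.dropUntil u hu).length = p.length := by
    rw [← Walk.length_append, Walk.take_spec]
  have h4 : p.length = Γ.dist x y := hp
  have h5 := hΓ.dist_triangle (u := x) (v := u) (w := y)
  omega

/-- A geodesic in a slim triangle contains a point whose distance to the opposite corner is
bounded above by the Gromov product. -/
theorem HasSlimTriangles.exists_dist_le {δ : ℕ} (h : Γ.HasSlimTriangles δ) (hΓ : Γ.Connected)
    {x z : V} (w : V) (p : Γ.Walk x z) (hp : p.IsGeodesicWalk) :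
    ∃ u ∈ p.support,
      2 * Γ.dist u w + Γ.dist x z ≤ Γ.dist x w + Γ.dist z w + (4 * δ + 2) := by
  classical
  obtain ⟨q, hq⟩ := hΓ.exists_walk_length_eq_dist z w
  obtain ⟨r, hr⟩ := hΓ.exists_walk_length_eq_dist x w
  have hslim := h x z w p q r hp hq hr
  -- The first vertex of `p` that is `δ`-close to `q` is also `(δ + 1)`-close to `r`, since by
  -- slimness its predecessor is `δ`-close to `r`.
  let Q : ℕ → Prop := fun i => ∃ v ∈ q.support, Γ.dist (p.getVert i) v ≤ δ
  have hQ : ∃ i, Q i := ⟨p.length, z, q.start_mem_support, by simp⟩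
  obtain ⟨v, hv, hvd⟩ := Nat.find_spec hQ
  set i := Nat.find hQ with hi
  have hP : ∃ v' ∈ r.support, Γ.dist (p.getVert i) v' ≤ δ + 1 := by
    rcases Nat.eq_zero_or_pos i with h0 | h0
    · exact ⟨x, r.start_mem_support, by simp [h0]⟩
    · obtain ⟨j, hj⟩ : ∃ j, i = j + 1 := ⟨i - 1, by omega⟩
      have hnot : ¬ Q j := Nat.find_min hQ (by omega)
      obtain ⟨v', hv' | hv', hd⟩ := hslim (p.getVert j) (p.getVert_mem_support j)
      · exact absurd ⟨v', hv', hd⟩ hnot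
      · refine ⟨v', hv', ?_⟩
        have h1 : Γ.dist (p.getVert i) (p.getVert j) ≤ 1 := by
          rw [hj]
          rcases lt_or_ge j p.length with hl | hl
          · exact (dist_eq_one_iff_adj.2 (p.adj_getVert_succ hl).symm).le
          · simp [p.getVert_of_length_le hl, p.getVert_of_length_le (Nat.le_succ_of_le hl)]
        have := hΓ.dist_triangle (u := p.getVert i) (v := p.getVert j) (w := v')
        omega
  obtain ⟨v', hv', hvd'⟩ := hP
  refine ⟨p.getVert i, p.getVert_mem_support i, ?_⟩
  set u := p.getVert i
  have e1 := Walk.IsGeodesicWalk.dist_add_dist hq hΓ hv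
  have e2 := Walk.IsGeodesicWalk.dist_add_dist hr hΓ hv'
  have e3 := Walk.IsGeodesicWalk.dist_add_dist hp hΓ (p.getVert_mem_support i)
  have t1 := hΓ.dist_triangle (u := u) (v := v) (w := w)
  have t2 := hΓ.dist_triangle (u := u) (v := v') (w := w)
  have t3 := hΓ.dist_triangle (u := u) (v := v) (w := z)
  have t4 := hΓ.dist_triangle (u := x) (v := v') (w := u)
  have c1 := Γ.dist_comm (u := z) (v := v)
  have c2 := Γ.dist_comm (u := u) (v := v')
  change Γ.dist x u + Γ.dist u z = _ at e3
  omega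

/-- Slim triangles imply Gromov's four-point condition. -/
theorem HasSlimTriangles.four_point {δ : ℕ} (h : Γ.HasSlimTriangles δ) (hΓ : Γ.Connected)
    (x z y w : V) : Γ.dist x z + Γ.dist y w ≤
      max (Γ.dist x y + Γ.dist z w) (Γ.dist x w + Γ.dist z y) + (6 * δ + 2) := by
  obtain ⟨p, hp⟩ := hΓ.exists_walk_length_eq_dist x z
  obtain ⟨q, hq⟩ := hΓ.exists_walk_length_eq_dist z y
  obtain ⟨r, hr⟩ := hΓ.exists_walk_length_eq_dist x y
  -- The distance from `y` to `w` is estimated through `u` and a `δ`-close point `v` on another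
  -- side; the side containing `v` decides which term of the maximum is the bound.
  obtain ⟨u, hu, hud⟩ := h.exists_dist_le hΓ w p hp
  obtain ⟨v, hv, hd⟩ := h x z y p q r hp hq hr u hu
  have t1 := hΓ.dist_triangle (u := v) (v := u) (w := w)
  have c1 := Γ.dist_comm (u := u) (v := v)
  have t2 := hΓ.dist_triangle (u := y) (v := v) (w := w)
  have c2 := Γ.dist_comm (u := y) (v := v)
  rcases hv with hv | hv
  · have e := Walk.IsGeodesicWalk.dist_add_dist hq hΓ hv
    have t3 := hΓ.dist_triangle (u := z) (v := v) (w := w)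
    omega
  · have e := Walk.IsGeodesicWalk.dist_add_dist hr hΓ hv
    have t3 := hΓ.dist_triangle (u := x) (v := v) (w := w)
    omega

/-! ### Cayley graphs: connectedness, left invariance, finite balls. -/

section Cayley

variable {G : Type*} [Group G] {A : Set G}

theorem mulCayley_connected (hA : Subgroup.closure A = ⊤) : (mulCayley A).Connected := by
  have key : ∀ g : G, ∀ a : G, (mulCayley A).Reachable a (a * g) := by
    intro g
    have hg : g ∈ Subgroup.closure A := hA ▸ Subgroup.mem_top g
    induction hg using Subgroup.closure_induction with
    | mem x hx =>
      intro a
      by_cases h : a = a * x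
      · rw [← h]
      · exact Adj.reachable ((mulCayley_adj A _ _).2 ⟨h, Or.inl (by simpa using hx)⟩)
    | one => intro a; simp
    | mul x y _ _ hx hy => intro a; rw [← mul_assoc]; exact (hx a).trans (hy _)
    | inv x _ hx => intro a; simpa using (hx (a * x⁻¹)).symm
  exact ⟨fun a b => by simpa using key (a⁻¹ * b) a⟩

theorem mulCayley_dist_mul_left_le (hA : Subgroup.closure A = ⊤) (a g h : G) :
    (mulCayley A).dist (a * g) (a * h) ≤ (mulCayley A).dist g h := by
  obtain ⟨p, hp⟩ := (mulCayley_connected hA).exists_walk_length_eq_dist g h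
  let f : mulCayley A →g mulCayley A := ⟨fun x => a * x, fun h => mulCayley_adj_mul_iff_right.2 h⟩
  have := (mulCayley A).dist_le (p.map f)
  rw [Walk.length_map, hp] at this
  exact this

theorem mulCayley_dist_mul_left (hA : Subgroup.closure A = ⊤) (a g h : G) :
    (mulCayley A).dist (a * g) (a * h) = (mulCayley A).dist g h := by
  refine le_antisymm (mulCayley_dist_mul_left_le hA a g h) ?_
  simpa using mulCayley_dist_mul_left_le hA a⁻¹ (a * g) (a * h)

theorem finite_setOf_mulCayley_dist_le (hfin : A.Finite) (hA : Subgroup.closure A = ⊤) (n : ℕ) :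
    {g : G | (mulCayley A).dist 1 g ≤ n}.Finite := by
  have hc := mulCayley_connected hA
  induction n with
  | zero =>
    refine (Set.finite_singleton (1 : G)).subset fun g hg => ?_
    have : (mulCayley A).dist 1 g = 0 := Nat.le_zero.1 hg
    exact (hc.dist_eq_zero_iff.1 this).symm
  | succ n ih =>
    refine (ih.union ((ih.mul (hfin.union hfin.inv)))).subset fun g hg => ?_
    obtain ⟨p, hp⟩ := hc.exists_walk_length_eq_dist 1 g
    by_cases hle : (mulCayley A).dist 1 g ≤ n
    · exact Or.inl hle
    right
    have hg' : (mulCayley A).dist 1 g ≤ n + 1 := hg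
    have hlen : p.length = n + 1 := by omega
    have hadj := p.adj_getVert_succ (i := n) (by omega)
    rw [← hlen, p.getVert_length] at hadj
    have h1 : (mulCayley A).dist 1 (p.getVert n) ≤ n := by
      have := (mulCayley A).dist_le (p.take n)
      rw [Walk.take_length] at this
      omega
    refine Set.mem_mul.2 ⟨p.getVert n, h1, (p.getVert n)⁻¹ * g, ?_, by group⟩
    rcases ((mulCayley_adj A _ _).1 hadj).2 with h | h
    · exact Or.inl h
    · exact Or.inr (by simpa using h)

end Cayley

end SimpleGraph

/-! ### Hyperbolic word lengths. -/

/-- A word length on a group, whose balls are finite, which admits geodesics, and whose left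
invariant metric satisfies Gromov's four-point condition with constant `δ`. -/
structure IsHyperbolicLength {G : Type*} [Group G] (ℓ : G → ℤ) (δ : ℤ) : Prop where
  one : ℓ 1 = 0
  inv : ∀ g, ℓ g⁻¹ = ℓ g
  mul_le : ∀ g h, ℓ (g * h) ≤ ℓ g + ℓ h
  finite_ball : ∀ n : ℤ, {g | ℓ g ≤ n}.Finite
  geodesic : ∀ g, ∃ (n : ℕ) (u : ℕ → G), (n : ℤ) = ℓ g ∧ u 0 = 1 ∧ u n = g ∧
    ∀ i, ℓ ((u i)⁻¹ * u (i + 1)) ≤ 1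
  four_point : ∀ p q r s : G, ℓ (p⁻¹ * q) + ℓ (r⁻¹ * s) ≤
    max (ℓ (p⁻¹ * r) + ℓ (q⁻¹ * s)) (ℓ (p⁻¹ * s) + ℓ (q⁻¹ * r)) + δ

theorem IsHyperbolicGroup.exists_isHyperbolicLength {G : Type*} [Group G]
    (hG : IsHyperbolicGroup G) : ∃ (ℓ : G → ℤ) (δ : ℤ), IsHyperbolicLength ℓ δ := by
  obtain ⟨A, hfin, hA, δ, hδ⟩ := hG
  have hc := SimpleGraph.mulCayley_connected hA
  have hd : ∀ g h : G, (SimpleGraph.mulCayley A).dist 1 (g⁻¹ * h) =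
      (SimpleGraph.mulCayley A).dist g h := fun g h => by
    simpa using SimpleGraph.mulCayley_dist_mul_left hA g⁻¹ g h
  refine ⟨fun g => ((SimpleGraph.mulCayley A).dist 1 g : ℤ), 6 * δ + 2, ?_, ?_, ?_, ?_, ?_, ?_⟩
  · simp
  · intro g
    rw [Nat.cast_inj, ← mul_one g⁻¹, hd, SimpleGraph.dist_comm]
  · intro g h
    have h1 := hc.dist_triangle (u := 1) (v := g) (w := g * h)
    rw [← hd g] at h1
    rw [inv_mul_cancel_left] at h1
    exact_mod_cast h1
  · intro n
    refine (SimpleGraph.finite_setOf_mulCayley_dist_le hfin hA n.toNat).subset fun g hg => ?_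
    have : ((SimpleGraph.mulCayley A).dist 1 g : ℤ) ≤ n := hg
    change (SimpleGraph.mulCayley A).dist 1 g ≤ n.toNat
    omega
  · intro g
    obtain ⟨p, hp⟩ := hc.exists_walk_length_eq_dist 1 g
    refine ⟨p.length, p.getVert, by rw [hp], p.getVert_zero, p.getVert_length, fun i => ?_⟩
    rw [hd]
    rcases lt_or_ge i p.length with hl | hl
    · rw [SimpleGraph.dist_eq_one_iff_adj.2 (p.adj_getVert_succ hl)]; rfl
    · simp [p.getVert_of_length_le hl, p.getVert_of_length_le (Nat.le_succ_of_le hl)]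
  · intro p q r s
    simp only [hd]
    exact_mod_cast hδ.four_point hc p q r s

/-! ### Torsion-freeness and undistorted subgroups. -/

theorem IsTorsionFreeGroup.pow_eq_one {G : Type*} [Group G] (htf : IsTorsionFreeGroup G) {x : G}
    {n : ℕ} (hn : n ≠ 0) (h : x ^ n = 1) : x = 1 :=
  htf x (isOfFinOrder_iff_pow_eq_one.2 ⟨n, Nat.pos_of_ne_zero hn, h⟩)

theorem IsTorsionFreeGroup.zpow_eq_one {G : Type*} [Group G] (htf : IsTorsionFreeGroup G) {x : G}
    {n : ℤ} (hn : n ≠ 0) (h : x ^ n = 1) : x = 1 :=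
  htf x (isOfFinOrder_iff_zpow_eq_one.2 ⟨n, hn, h⟩)

/-- In a finitely generated torsion-free abelian group, homomorphisms to `ℤ` separate points. -/
theorem exists_addMonoidHom_int_ne_zero {A : Type*} [CommGroup A] [Group.FG A]
    (htf : IsTorsionFreeGroup A) {x : A} (hx : x ≠ 1) :
    ∃ φ : Additive A →+ ℤ, φ (Additive.ofMul x) ≠ 0 := by
  have : IsMulTorsionFree A := ⟨fun n hn a b hab => by
    have : (a / b) ^ n = 1 := by rw [div_pow, div_eq_one]; exact hab
    exact div_eq_one.1 (htf.pow_eq_one hn this)⟩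
  have : Module.Finite ℤ (Additive A) := Module.Finite.iff_addGroup_fg.2 inferInstance
  let b := Module.Free.chooseBasis ℤ (Additive A)
  by_contra! h
  refine hx (Additive.ofMul.injective (b.ext_elem fun i => ?_))
  simpa using h (b.coord i).toAddMonoidHom

namespace IsHyperbolicLength

variable {G : Type*} [Group G] {ℓ : G → ℤ} {δ : ℤ}

section

variable (h : IsHyperbolicLength ℓ δ)
include h

theorem nonneg (g : G) : 0 ≤ ℓ g := by
  have h1 := h.mul_le g g⁻¹
  rw [mul_inv_cancel, h.one, h.inv] at h1
  omega

theorem const_nonneg : 0 ≤ δ := by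
  have := h.four_point 1 1 1 1
  simp [h.one] at this
  exact this

theorem dist_comm (p q : G) : ℓ (p⁻¹ * q) = ℓ (q⁻¹ * p) := by
  rw [← h.inv]; simp

theorem dist_triangle (p q r : G) : ℓ (p⁻¹ * r) ≤ ℓ (p⁻¹ * q) + ℓ (q⁻¹ * r) := by
  have := h.mul_le (p⁻¹ * q) (q⁻¹ * r)
  rwa [show p⁻¹ * q * (q⁻¹ * r) = p⁻¹ * r by group] at this

/-- The powers of an element of infinite order leave every ball. -/
theorem exists_forall_lt_pow (htf : IsTorsionFreeGroup G) {x : G} (hx : x ≠ 1) (B : ℤ) :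
    ∃ N : ℕ, ∀ k ≥ N, B < ℓ (x ^ k) := by
  have hinj : Function.Injective (fun k : ℕ => x ^ k) :=
    injective_pow_iff_not_isOfFinOrder.2 fun hf => hx (htf x hf)
  obtain ⟨N, hN⟩ := ((h.finite_ball B).preimage hinj.injOn).bddAbove
  refine ⟨N + 1, fun k hk => ?_⟩
  by_contra! hc
  have : k ≤ N := hN hc
  omega

/-- Centralizers of finite sets are finitely generated and undistorted. -/
theorem exists_finite_centralizer {S : Set G} (hS : S.Finite) :
    ∃ T : Set G, T.Finite ∧ T ⊆ Subgroup.centralizer S ∧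
      ∀ f ∈ Subgroup.centralizer S, ∃ L : List G, (∀ g ∈ L, g ∈ T) ∧ L.prod = f ∧
        (L.length : ℤ) ≤ ℓ f := by
  obtain ⟨B, hB⟩ := (hS.image ℓ).bddAbove
  have : Finite S := hS
  -- Along a geodesic `u` from `1` to `f`, the conjugates of `S` by `u j` stay in a ball, so `σ (u
  -- j)` takes finitely many values. Correcting `u j` by a representative `v` of its value gives
  -- centralizing elements `c j` from `1` to `f` whose successive quotients lie in a finite set.
  let σ : G → S → G := fun u s => u⁻¹ * s * u
  let v : (S → G) → G := Function.invFun σ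
  have hv : ∀ u, σ (v (σ u)) = σ u := fun u => Function.invFun_eq ⟨u, rfl⟩
  let St : Set (S → G) := Set.pi Set.univ fun _ => {g | ℓ g ≤ B + δ}
  have hSt : St.Finite := Set.Finite.pi fun _ => h.finite_ball _
  let F : (S → G) × (S → G) × G → G := fun t =>
    (v (σ 1))⁻¹ * (v t.1 * t.2.2 * (v t.2.1)⁻¹) * v (σ 1)
  refine ⟨F '' (St ×ˢ St ×ˢ {g | ℓ g ≤ 1}) ∩ Subgroup.centralizer S,
    ((hSt.prod (hSt.prod (h.finite_ball 1))).image F).inter_of_left _, Set.inter_subset_right,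
    fun f hf => ?_⟩
  obtain ⟨n, u, hn, hu0, hun, hu⟩ := h.geodesic f
  have hle : ∀ i j : ℕ, ℓ ((u i)⁻¹ * u (i + j)) ≤ j := by
    intro i j
    induction j with
    | zero => simp [h.one]
    | succ j ih =>
      have h1 := h.dist_triangle (u i) (u (i + j)) (u (i + (j + 1)))
      have h2 := hu (i + j)
      rw [add_assoc] at h2
      push_cast
      omega
  have hstate : ∀ j ≤ n, σ (u j) ∈ St := by
    intro j hj
    refine Set.mem_univ_pi.2 fun s => ?_
    have hsf : (s : G) * f = f * s := Subgroup.mem_centralizer_iff.1 hf s s.2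
    -- As `s` commutes with `f`, both `u j` and `s * u j` are within `j + B` of `1` and `n - j + B`
    -- of `f`, so they are close to each other.
    have h4 := h.four_point (u j) (s * u j) 1 f
    have e1 : (s * u j)⁻¹ * f = (u j)⁻¹ * f * (f⁻¹ * (s : G)⁻¹ * f) := by group
    have e2 : f⁻¹ * (s : G)⁻¹ * f = (s : G)⁻¹ := by
      rw [mul_assoc, inv_mul_eq_iff_eq_mul, inv_mul_eq_iff_eq_mul, ← mul_assoc, hsf]; simp
    have b1 := h.mul_le ((u j)⁻¹ * f) (s : G)⁻¹
    have b2 := h.mul_le (s : G) (u j)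
    have b3 := hle 0 j
    have b4 := hle j (n - j)
    rw [Nat.add_sub_cancel' hj, hun] at b4
    rw [hu0, zero_add, inv_one, one_mul] at b3
    rw [e1, e2, ← mul_assoc, mul_one, mul_one, h.inv (u j), h.inv (s * u j), inv_one,
      one_mul] at h4
    have b5 : ℓ s ≤ B := hB ⟨s, s.2, rfl⟩
    rw [h.inv] at b1
    have hcast : ((n - j : ℕ) : ℤ) = n - j := by omega
    change ℓ ((u j)⁻¹ * s * u j) ≤ B + δ
    omega
  let c : ℕ → G := fun j => u j * (v (σ (u j)))⁻¹ * v (σ 1)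
  have hc : ∀ j, c j ∈ Subgroup.centralizer S := by
    intro j
    refine Subgroup.mem_centralizer_iff.2 fun s hs => ?_
    have e1 : (v (σ (u j)))⁻¹ * s * v (σ (u j)) = (u j)⁻¹ * s * u j :=
      congrFun (hv (u j)) ⟨s, hs⟩
    have e2 : (v (σ 1))⁻¹ * s * v (σ 1) = (1 : G)⁻¹ * s * 1 := congrFun (hv 1) ⟨s, hs⟩
    have e2' : s * v (σ 1) = v (σ 1) * s := by
      rw [mul_assoc, inv_mul_eq_iff_eq_mul] at e2; simpa using e2
    calc s * c j = u j * ((u j)⁻¹ * s * u j) * (v (σ (u j)))⁻¹ * v (σ 1) := by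
          simp only [c]; group
      _ = u j * (v (σ (u j)))⁻¹ * (s * v (σ 1)) := by rw [← e1]; group
      _ = c j * s := by rw [e2']; simp only [c]; group
  have hc0 : c 0 = 1 := by simp [c, hu0]
  have hcn : c n = f := by
    have : σ (u n) = σ 1 := by
      funext s
      have hsf : (s : G) * f = f * s := Subgroup.mem_centralizer_iff.1 hf s s.2
      simp only [σ, hun]
      rw [mul_assoc, hsf]; simp
    simp only [c]
    rw [this, hun, inv_mul_cancel_right]
  have hstep : ∀ j < n, (c j)⁻¹ * c (j + 1) ∈
      F '' (St ×ˢ St ×ˢ {g | ℓ g ≤ 1}) ∩ Subgroup.centralizer S := by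
    intro j hj
    refine ⟨⟨(σ (u j), σ (u (j + 1)), (u j)⁻¹ * u (j + 1)),
      ⟨hstate j hj.le, hstate (j + 1) hj, hu j⟩, ?_⟩, mul_mem (inv_mem (hc j)) (hc (j + 1))⟩
    simp only [F, c]
    group
  have key : ∀ j ≤ n, ∃ L : List G, (∀ g ∈ L, g ∈ F '' (St ×ˢ St ×ˢ {g | ℓ g ≤ 1}) ∩
      Subgroup.centralizer S) ∧ L.prod = c j ∧ L.length = j := by
    intro j
    induction j with
    | zero => exact fun _ => ⟨[], by simp, by simp [hc0], rfl⟩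
    | succ j ih =>
      intro hj
      obtain ⟨L, hL, hp, hl⟩ := ih (by omega)
      refine ⟨L ++ [(c j)⁻¹ * c (j + 1)], fun g hg => ?_, by simp [hp], by simp [hl]⟩
      rcases List.mem_append.1 hg with hg | hg
      · exact hL g hg
      · rw [List.mem_singleton.1 hg]; exact hstep j (by omega)
  obtain ⟨L, hL, hp, hl⟩ := key n le_rfl
  exact ⟨L, hL, by rw [hp, hcn], by rw [hl, hn]⟩

/-- Cyclic subgroups of a torsion-free hyperbolic group are undistorted. -/
theorem exists_le_mul_length_pow (htf : IsTorsionFreeGroup G) {x : G} (hx : x ≠ 1) :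
    ∃ L : ℤ, 0 < L ∧ ∀ k : ℕ, (k : ℤ) ≤ L * ℓ (x ^ k) := by
  obtain ⟨T₁, hT₁, hT₁x, hgen₁⟩ := h.exists_finite_centralizer (Set.finite_singleton x)
  obtain ⟨T₂, hT₂, hT₂x, hgen₂⟩ := h.exists_finite_centralizer hT₁
  -- `T₁` generates the centralizer of `x`, so `A` is the centre of that centralizer: a finitely
  -- generated torsion-free abelian group containing `x`, with word length at most `ℓ`. A
  -- homomorphism to `ℤ` that is nonzero on `x` then bounds `ℓ (x ^ k)` from below.
  let A := Subgroup.centralizer T₁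
  have hA : ∀ a ∈ A, ∀ f ∈ Subgroup.centralizer {x}, f * a = a * f := by
    intro a ha f hf
    obtain ⟨L, hL, rfl, -⟩ := hgen₁ f hf
    exact (Commute.list_prod_left L a fun g hg =>
      Subgroup.mem_centralizer_iff.1 ha g (hL g hg))
  have hxA : x ∈ A := Subgroup.mem_centralizer_iff.2 fun t ht =>
    (Subgroup.mem_centralizer_iff.1 (hT₁x ht) x rfl).symm
  have hxC : x ∈ Subgroup.centralizer {x} := Subgroup.mem_centralizer_iff.2 fun t ht => by
    rw [Set.mem_singleton_iff.1 ht]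
  have hAC : ∀ a ∈ A, a ∈ Subgroup.centralizer {x} := fun a ha =>
    Subgroup.mem_centralizer_iff.2 fun t ht => by
      rw [Set.mem_singleton_iff.1 ht]; exact hA a ha x hxC
  let _ : CommGroup A := { (inferInstance : Group A) with
    mul_comm := fun a b => Subtype.ext (hA b b.2 a (hAC a a.2)) }
  have hclosure : Subgroup.closure ((↑) ⁻¹' T₂ : Set A) = ⊤ := by
    refine eq_top_iff.2 fun f _ => ?_
    obtain ⟨L, hL, hp, -⟩ := hgen₂ f f.2
    have : ∀ L : List G, (∀ g ∈ L, g ∈ T₂) → ∃ a ∈ Subgroup.closure ((↑) ⁻¹' T₂ : Set A),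
        (a : G) = L.prod := by
      intro L
      induction L with
      | nil => exact fun _ => ⟨1, one_mem _, rfl⟩
      | cons g L ih =>
        intro hL
        obtain ⟨a, ha, hap⟩ := ih fun t ht => hL t (by simp [ht])
        have hg := hL g (by simp)
        exact ⟨⟨g, hT₂x hg⟩ * a, mul_mem (Subgroup.subset_closure hg) ha, by simp [hap]⟩
    obtain ⟨a, ha, hap⟩ := this L hL
    rwa [← Subtype.ext (hap.trans hp)]
  have : Group.FG A := Group.fg_iff.2 ⟨_, hclosure, hT₂.preimage Subtype.val_injective.injOn⟩
  have htfA : IsTorsionFreeGroup A := fun a ha =>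
    Subtype.ext (htf a (A.subtype.isOfFinOrder ha))
  obtain ⟨φ, hφ⟩ := exists_addMonoidHom_int_ne_zero htfA (x := ⟨x, hxA⟩)
    fun hc => hx (congrArg Subtype.val hc)
  obtain ⟨B, hB⟩ := ((hT₂.preimage (Subtype.val_injective (p := (· ∈ A))).injOn).image
    fun a => |φ (Additive.ofMul a)|).bddAbove
  have hbound : ∀ L : List G, (∀ g ∈ L, g ∈ T₂) → ∀ a : A, (a : G) = L.prod →
      |φ (Additive.ofMul a)| ≤ (|B| + 1) * L.length := by
    intro L
    induction L with
    | nil =>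
      intro _ a ha
      have : a = 1 := Subtype.ext ha
      simp [this]
    | cons g L ih =>
      intro hL a ha
      have hg := hL g (by simp)
      let g' : A := ⟨g, hT₂x hg⟩
      have h1 := ih (fun t ht => hL t (by simp [ht])) (g'⁻¹ * a) (by simp [ha, g'])
      have h2 : |φ (Additive.ofMul g')| ≤ B := hB ⟨g', hg, rfl⟩
      have h3 : φ (Additive.ofMul a) =
          φ (Additive.ofMul g') + φ (Additive.ofMul (g'⁻¹ * a)) := by
        rw [← map_add, ← ofMul_mul, mul_inv_cancel_left]
      have h4 := abs_add_le (φ (Additive.ofMul g')) (φ (Additive.ofMul (g'⁻¹ * a)))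
      have h5 := le_abs_self B
      rw [h3, List.length_cons]
      push_cast
      linarith
  refine ⟨|B| + 1, by positivity, fun k => ?_⟩
  obtain ⟨L, hL, hp, hl⟩ := hgen₂ (x ^ k) (pow_mem hxA k)
  have h1 := hbound L hL (⟨x, hxA⟩ ^ k) (by simp [hp])
  rw [ofMul_pow, map_nsmul, nsmul_eq_mul, abs_mul, Nat.abs_cast] at h1
  have h2 : 1 ≤ |φ (Additive.ofMul ⟨x, hxA⟩)| := Int.one_le_abs hφ
  have h3 : (|B| + 1) * L.length ≤ (|B| + 1) * ℓ (x ^ k) := by gcongr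
  nlinarith [Int.natCast_nonneg k]

/-- Doubling the exponent of some power increases its length by more than a given constant. -/
theorem exists_add_lt_length_pow_two_mul (htf : IsTorsionFreeGroup G) {x : G} (hx : x ≠ 1)
    (B : ℤ) : ∃ k : ℕ, k ≠ 0 ∧ ℓ (x ^ k) + B < ℓ (x ^ (2 * k)) := by
  obtain ⟨L, hL, hlin⟩ := h.exists_le_mul_length_pow htf hx
  by_contra! hc
  -- If every doubling added at most `B`, the length of `x ^ 2 ^ m` would be linear in `m`, against
  -- undistortedness.
  have hlog : ∀ m : ℕ, ℓ (x ^ 2 ^ m) ≤ ℓ x + |B| * m := by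
    intro m
    induction m with
    | zero => simp
    | succ m ih =>
      have h1 := hc (2 ^ m) (by positivity)
      rw [← pow_succ'] at h1
      have h2 := le_abs_self B
      push_cast
      linarith
  have hx0 := h.nonneg x
  -- Chosen so that `(j + 1) ^ 2`, a lower bound for `2 ^ (2 * j)`, already exceeds `L * (ℓ x + |B|
  -- * (2 * j))`.
  obtain ⟨j, hj⟩ : ∃ j : ℕ, (j : ℤ) = L * (ℓ x + 2 * |B|) :=
    ⟨(L * (ℓ x + 2 * |B|)).toNat, Int.toNat_of_nonneg (by positivity)⟩
  have h1 := hlin (2 ^ (2 * j))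
  have h2 := mul_le_mul_of_nonneg_left (hlog (2 * j)) hL.le
  have h3 : ((j : ℤ) + 1) ^ 2 ≤ ((2 ^ (2 * j) : ℕ) : ℤ) := by
    rw [mul_comm 2 j, pow_mul]
    have : j + 1 ≤ 2 ^ j := Nat.lt_two_pow_self
    exact_mod_cast Nat.pow_le_pow_left this 2
  have h4 : 0 ≤ L * ℓ x * j := by positivity
  have h5 : 0 ≤ L * |B| := by positivity
  have h6 : (j : ℤ) * j = L * ℓ x * j + 2 * (L * |B| * j) := by nth_rw 1 [hj]; ring
  have h7 : 0 ≤ L * ℓ x := by positivity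
  push_cast at *
  nlinarith

end

end IsHyperbolicLength

/-! ### Axial elements, their centralizers and the overlap of axes. -/

/-- The length is additive on the positive powers of `x` up to the constant `C`; equivalently, the
powers of `x` lie within bounded distance of geodesics. -/
def IsAxial {G : Type*} [Group G] (ℓ : G → ℤ) (x : G) (C : ℤ) : Prop :=
  ∀ i j : ℕ, ℓ (x ^ i) + ℓ (x ^ j) ≤ ℓ (x ^ (i + j)) + C

theorem IsAxial.pow {G : Type*} [Group G] {ℓ : G → ℤ} {x : G} {C : ℤ} (hx : IsAxial ℓ x C)
    (k : ℕ) : IsAxial ℓ (x ^ k) C := fun i j => by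
  simpa only [← pow_mul, mul_add] using hx (k * i) (k * j)

namespace IsHyperbolicLength

variable {G : Type*} [Group G] {ℓ : G → ℤ} {δ : ℤ}

section

variable (h : IsHyperbolicLength ℓ δ)
include h

theorem isAxial_inv {x : G} {C : ℤ} (hx : IsAxial ℓ x C) : IsAxial ℓ x⁻¹ C := fun i j => by
  simpa only [inv_pow, h.inv] using hx i j

theorem length_pow_le (x : G) (n : ℕ) : ℓ (x ^ n) ≤ n * ℓ x := by
  induction n with
  | zero => simp [h.one]
  | succ n ih =>
    have := h.mul_le (x ^ n) x
    rw [pow_succ]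
    push_cast
    linarith

theorem length_zpow (x : G) (n : ℤ) : ℓ (x ^ n) = ℓ (x ^ n.natAbs) := by
  obtain ⟨m, rfl | rfl⟩ := n.eq_nat_or_neg <;> simp [h.inv]

/-- A local criterion for being axial. -/
theorem isAxial_of_lt {w : G} {β : ℤ} (hβ : 2 * ℓ w ≤ ℓ (w ^ 2) + β) (hw : β + 2 * δ < ℓ w) :
    IsAxial ℓ w (β + 2 * δ) := by
  have hδ := h.const_nonneg
  have hβ0 : 0 ≤ β := by
    have := h.mul_le w w
    rw [← sq] at this
    omega
  have h4 : ∀ i j k : ℕ, ℓ (w ^ (i + j)) + ℓ (w ^ (j + k)) ≤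
      max (ℓ (w ^ i) + ℓ (w ^ k)) (ℓ (w ^ (i + j + k)) + ℓ (w ^ j)) + δ := by
    intro i j k
    have := h.four_point 1 (w ^ (i + j)) (w ^ i) (w ^ (i + j + k))
    rw [h.dist_comm (w ^ (i + j)) (w ^ i)] at this
    simp only [inv_one, one_mul] at this
    rw [show (w ^ i)⁻¹ * w ^ (i + j + k) = w ^ (j + k) by
        rw [add_assoc, pow_add w i, inv_mul_cancel_left],
      show (w ^ (i + j))⁻¹ * w ^ (i + j + k) = w ^ k by rw [pow_add w (i + j), inv_mul_cancel_left],
      show (w ^ i)⁻¹ * w ^ (i + j) = w ^ j by rw [pow_add, inv_mul_cancel_left]] at this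
    exact this
  -- Each further factor adds more than `δ`, which excludes the first term of the maximum in `h4`.
  have h1 : ∀ i : ℕ, ℓ (w ^ i) + ℓ w - β - δ ≤ ℓ (w ^ (i + 1)) := by
    intro i
    induction i with
    | zero => simp [h.one]; omega
    | succ i ih =>
      have := h4 i 1 1
      simp only [pow_one, Nat.reduceAdd] at this
      omega
  intro i j
  rcases j with _ | j
  · simp [h.one]; omega
  · have e1 := h4 i 1 j
    have e2 := h1 i
    have e3 := h1 j
    rw [add_comm 1 j, show i + 1 + j = i + (j + 1) by ring] at e1
    simp only [pow_one] at e1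
    omega

/-- If doubling the exponent `k` gains more than `2 * δ`, the defect `β` of `x ^ k` is small enough
for the local criterion. -/
theorem exists_isAxial_pow (htf : IsTorsionFreeGroup G) {x : G} (hx : x ≠ 1) :
    ∃ k : ℕ, k ≠ 0 ∧ ∃ C, IsAxial ℓ (x ^ k) C := by
  obtain ⟨k, hk, hlt⟩ := h.exists_add_lt_length_pow_two_mul htf hx (2 * δ)
  rw [pow_mul'] at hlt
  exact ⟨k, hk, _, h.isAxial_of_lt (β := 2 * ℓ (x ^ k) - ℓ ((x ^ k) ^ 2)) (by omega) (by omega)⟩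

/-- A point near a geodesic from `1` to a power of an axial element is close to a smaller power. -/
theorem exists_pow_near {x : G} {C : ℤ} (hx : IsAxial ℓ x C) {t : G} {l : ℕ} {b : ℤ}
    (ht : ℓ t + ℓ (t⁻¹ * x ^ l) ≤ ℓ (x ^ l) + b) :
    ∃ i ≤ l, ℓ ((x ^ i)⁻¹ * t) ≤ C + b + ℓ x + δ := by
  have hδ := h.const_nonneg
  have hC : 0 ≤ C := by simpa [h.one] using hx 0 0
  have hxn := h.nonneg x
  have hb : 0 ≤ b := by
    have := h.mul_le t (t⁻¹ * x ^ l)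
    rw [mul_inv_cancel_left] at this
    omega
  by_cases hr : ℓ (x ^ l) ≤ ℓ t
  · refine ⟨l, le_rfl, ?_⟩
    rw [h.dist_comm]
    omega
  -- Take `i + 1` to be the first exponent with `x ^ (i + 1)` longer than `t`; then `x ^ i` and `t`
  -- are almost equally far from `1`, and the four-point inequality makes them close.
  · have hex : ∃ j, ℓ t < ℓ (x ^ j) := ⟨l, by omega⟩
    obtain ⟨i, hi⟩ : ∃ i, Nat.find hex = i + 1 := by
      refine Nat.exists_eq_succ_of_ne_zero fun h0 => ?_
      have := Nat.find_spec hex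
      rw [h0, pow_zero, h.one] at this
      have := h.nonneg t
      omega
    have h1 : ℓ (x ^ i) ≤ ℓ t := not_lt.1 (Nat.find_min hex (by omega))
    have h2 : ℓ t < ℓ (x ^ (i + 1)) := hi ▸ Nat.find_spec hex
    have hil : i + 1 ≤ l := hi ▸ Nat.find_min' hex (by omega)
    have h3 := h.mul_le (x ^ i) x
    rw [← pow_succ] at h3
    have h4 := h.four_point (x ^ i) t 1 (x ^ l)
    have h5 := hx i (l - i)
    rw [Nat.add_sub_cancel' (by omega)] at h5
    have e1 : (x ^ i)⁻¹ * x ^ l = x ^ (l - i) := by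
      rw [inv_mul_eq_iff_eq_mul, ← pow_add, Nat.add_sub_cancel' (by omega)]
    rw [e1, mul_one, mul_one, h.inv, h.inv t, inv_one, one_mul] at h4
    exact ⟨i, by omega, by omega⟩

/-- An element of the centralizer of an axial element moves points of its axis to points near the
axis. -/
theorem exists_forall_length_add_le (htf : IsTorsionFreeGroup G) {w : G} {C : ℤ}
    (hw : IsAxial ℓ w C) (hw1 : w ≠ 1) {t : G} (ht : Commute t w) :
    ∃ N : ℕ, ∀ M ≥ N, ℓ (t⁻¹ * w ^ M) + ℓ (w ^ M * t) ≤ ℓ (w ^ (2 * M)) + C + 2 * δ := by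
  obtain ⟨N, hN⟩ := h.exists_forall_lt_pow htf hw1 (2 * ℓ t + C + 2 * δ)
  refine ⟨N, fun M hM => ?_⟩
  have hlarge := hN M hM
  have hax := hw M M
  have hδ := h.const_nonneg
  have hc : w ^ M * t = t * w ^ M := (ht.pow_right M).eq.symm
  rw [two_mul]
  rw [pow_add] at *
  set W := w ^ M
  have hc' : W⁻¹ * t = t * W⁻¹ := by rw [inv_mul_eq_iff_eq_mul, ← mul_assoc, hc]; simp
  -- Since `t` commutes with `W`, it moves `W` and `W⁻¹` by only `ℓ t`. As `W` is long, pairings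
  -- using these short distances cannot attain the maximum; adding the two remaining inequalities
  -- gives the claim.
  have h1 := h.four_point t W (t * W) (t * W⁻¹)
  have h2 := h.four_point t W⁻¹ (t * W⁻¹) W
  rw [show (t * W)⁻¹ * (t * W⁻¹) = (W * W)⁻¹ by group, inv_mul_cancel_left, inv_mul_cancel_left,
    show W⁻¹ * (t * W) = t by rw [← hc]; simp, h.inv, h.inv] at h1
  rw [show (t * W⁻¹)⁻¹ * W = (W⁻¹ * (t * W⁻¹))⁻¹ by group, show t⁻¹ * W⁻¹ = (W * t)⁻¹ by group,
    inv_mul_cancel_left, inv_inv, show W * (t * W⁻¹) = t by rw [← mul_assoc, hc]; simp, h.inv,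
    h.inv, h.inv] at h2
  have h3 := h.mul_le t (t⁻¹ * W)
  have h4 := h.mul_le (W * t) t⁻¹
  rw [mul_inv_cancel_left] at h3
  rw [mul_inv_cancel_right, h.inv] at h4
  have hC : 0 ≤ C := by simpa [h.one] using hw 0 0
  have htn := h.nonneg t
  omega

/-- The centralizer of an axial element lies in a neighbourhood of the axis. -/
theorem exists_zpow_mul_le (htf : IsTorsionFreeGroup G) {x : G} {C : ℤ} (hx : IsAxial ℓ x C)
    (hx1 : x ≠ 1) : ∃ R : ℤ, ∀ t, Commute t x → ∃ k : ℤ, ℓ (x ^ k * t) ≤ R := by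
  refine ⟨C + (C + 2 * δ) + ℓ x + δ, fun t ht => ?_⟩
  obtain ⟨N, hN⟩ := h.exists_forall_length_add_le htf hx hx1 ht
  have h1 := hN N le_rfl
  have e : (x ^ N * t)⁻¹ * x ^ (2 * N) = t⁻¹ * x ^ N := by rw [two_mul, pow_add]; group
  obtain ⟨i, -, hi⟩ := h.exists_pow_near hx (t := x ^ N * t) (l := 2 * N) (b := C + 2 * δ)
    (by rw [e]; omega)
  refine ⟨N - i, ?_⟩
  rwa [show x ^ ((N : ℤ) - i) * t = (x ^ i)⁻¹ * (x ^ N * t) by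
    rw [sub_eq_neg_add, zpow_add, zpow_neg, zpow_natCast, zpow_natCast, mul_assoc]]

/-- In a torsion-free hyperbolic group, commutation is a transitive relation on nontrivial
elements. -/
theorem commute_trans (htf : IsTorsionFreeGroup G) {x : G} (hx : x ≠ 1) {a b : G}
    (ha : Commute a x) (hb : Commute b x) : Commute a b := by
  obtain ⟨k, hk, C, hC⟩ := h.exists_isAxial_pow htf hx
  have hxk : x ^ k ≠ 1 := fun hc => hx (htf.pow_eq_one hk hc)
  obtain ⟨R, hR⟩ := h.exists_zpow_mul_le htf hC hxk
  set z := x ^ k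
  let Z := Subgroup.centralizer {z}
  have mem_Z : ∀ {g}, g ∈ Z ↔ Commute g z := fun {g} =>
    Subgroup.mem_centralizer_iff.trans
      ⟨fun hg => (hg z rfl).symm, fun hg t ht => by rw [Set.mem_singleton_iff.1 ht]; exact hg.eq.symm⟩
  have hz : z ∈ Z := mem_Z.2 (Commute.refl z)
  have hcen : (⟨z, hz⟩ : Z) ∈ Subgroup.center Z :=
    Subgroup.mem_center_iff.2 fun g => Subtype.ext (mem_Z.1 g.2).eq
  have hfin : Set.Finite {g : Z | ℓ (g : G) ≤ R} :=
    Set.Finite.preimage (s := {g | ℓ g ≤ R}) Subtype.val_injective.injOn (h.finite_ball R)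
  have := hfin.to_subtype
  -- Modulo powers of the central element `z`, all of `Z` lies in a finite ball.
  have : Finite (Z ⧸ Subgroup.center Z) := by
    refine Finite.of_surjective (fun g : {g : Z | ℓ (g : G) ≤ R} => (g.1 : Z ⧸ Subgroup.center Z)) ?_
    intro q
    obtain ⟨g, rfl⟩ := QuotientGroup.mk_surjective q
    obtain ⟨n, hn⟩ := hR g (mem_Z.1 g.2)
    refine ⟨⟨⟨z, hz⟩ ^ n * g, hn⟩, ?_⟩
    have hmem := zpow_mem hcen n
    refine QuotientGroup.eq.2 ?_
    rw [mul_inv_rev, mul_assoc, ← Subgroup.mem_center_iff.1 (inv_mem hmem) g, inv_mul_cancel_left]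
    exact inv_mem hmem
  have : (Subgroup.center Z).FiniteIndex := Subgroup.finiteIndex_of_finite_quotient
  -- The transfer to the centre raises to the power of its index, so it is injective by
  -- torsion-freeness; hence `Z` is abelian.
  have hinj : Function.Injective (MonoidHom.transferCenterPow Z) := by
    refine (injective_iff_map_eq_one _).2 fun g hg => ?_
    have h1 : g ^ (Subgroup.center Z).index = 1 := congrArg Subtype.val hg
    have h2 : (g : G) ^ (Subgroup.center Z).index = 1 := congrArg Subtype.val h1
    exact Subtype.ext (htf.pow_eq_one Subgroup.FiniteIndex.index_ne_zero h2)
  have hcomm : (⟨a, mem_Z.2 (ha.pow_right k)⟩ : Z) * ⟨b, mem_Z.2 (hb.pow_right k)⟩ =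
      ⟨b, mem_Z.2 (hb.pow_right k)⟩ * ⟨a, mem_Z.2 (ha.pow_right k)⟩ := by
    apply hinj
    rw [map_mul, map_mul]
    exact Subtype.ext (Subgroup.mem_center_iff.1 (Subtype.property _) _)
  exact congrArg Subtype.val hcomm

/-- Conjugation by `f` changes lengths by at most `2 * ℓ f`, whereas for `|a| > |b|` axiality makes
`x ^ (|a| * n)` longer than `x ^ (|b| * n)` by an unbounded amount. -/
theorem natAbs_eq_of_conj_zpow (htf : IsTorsionFreeGroup G) {x f : G} {C : ℤ}
    (hx : IsAxial ℓ x C) (hx1 : x ≠ 1) {a b : ℤ} (hf : f * x ^ b * f⁻¹ = x ^ a) :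
    a.natAbs ≤ b.natAbs := by
  by_contra! hlt
  obtain ⟨N, hN⟩ := h.exists_forall_lt_pow htf hx1 (2 * ℓ f + C)
  have h1 : ∀ n : ℕ, ℓ (x ^ (a.natAbs * n)) ≤ ℓ (x ^ (b.natAbs * n)) + 2 * ℓ f := by
    intro n
    have e := h.length_zpow x (a * n)
    have e' := h.length_zpow x (b * n)
    rw [Int.natAbs_mul, Int.natAbs_natCast] at e e'
    have h2 : f * x ^ (b * n) * f⁻¹ = x ^ (a * n) := by
      rw [zpow_mul, zpow_mul, zpow_natCast, zpow_natCast, ← conj_pow, hf]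
    have h3 := h.mul_le (f * x ^ (b * n)) f⁻¹
    have h4 := h.mul_le f (x ^ (b * n))
    rw [h2, h.inv] at h3
    omega
  obtain ⟨m, hm⟩ : ∃ m, a.natAbs = b.natAbs + (m + 1) := ⟨a.natAbs - b.natAbs - 1, by omega⟩
  have h2 := hx (b.natAbs * N) ((m + 1) * N)
  have h3 := h1 N
  rw [← add_mul, ← hm] at h2
  have h4 := hN ((m + 1) * N) (by nlinarith)
  omega

/-- Comparing exponents for `f` and `f⁻¹` gives `a = ± b`. In the negative case `f ^ 2` commutes
with `x ^ b`, and transitivity passes this to `f`. -/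
theorem commute_of_conj_zpow (htf : IsTorsionFreeGroup G) {x f : G} {C : ℤ}
    (hx : IsAxial ℓ x C) (hx1 : x ≠ 1) {a b : ℤ} (ha : a ≠ 0) (hf : f * x ^ b * f⁻¹ = x ^ a) :
    Commute f x := by
  have hxb : ∀ b : ℤ, b ≠ 0 → Commute f (x ^ b) → Commute f x := fun b hb hc =>
    h.commute_trans htf (fun h1 => hx1 (htf.zpow_eq_one hb h1)) hc ((Commute.refl x).zpow_right b)
  have h1 := h.natAbs_eq_of_conj_zpow htf hx hx1 hf
  have h2 := h.natAbs_eq_of_conj_zpow htf hx hx1 (f := f⁻¹) (a := b) (b := a)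
    (by rw [← hf]; group)
  have hb : b ≠ 0 := by omega
  rcases Int.natAbs_eq_natAbs_iff.1 (le_antisymm h1 h2) with rfl | rfl
  · exact hxb a ha (mul_inv_eq_iff_eq_mul.1 hf)
  · have hsq : Commute (f ^ 2) (x ^ b) := by
      have e1 : f * x ^ b = (x ^ b)⁻¹ * f := by
        rw [← zpow_neg]; exact mul_inv_eq_iff_eq_mul.1 hf
      have e2 : f * (x ^ b)⁻¹ = x ^ b * f := by
        rw [mul_inv_eq_iff_eq_mul, mul_assoc, e1, mul_inv_cancel_left]
      change f ^ 2 * x ^ b = x ^ b * f ^ 2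
      rw [sq, mul_assoc, e1, ← mul_assoc, e2, mul_assoc]
    by_cases hf2 : f ^ 2 = 1
    · rw [htf.pow_eq_one two_ne_zero hf2]; exact Commute.one_left x
    · exact hxb b hb (h.commute_trans htf hf2 ((Commute.refl f).pow_right 2) hsq.symm)

/-- The centralizer of an axial element is malnormal. -/
theorem commute_of_commute_conj (htf : IsTorsionFreeGroup G) {x f : G} {C : ℤ}
    (hx : IsAxial ℓ x C) (hx1 : x ≠ 1) (hf : Commute (f * x * f⁻¹) x) : Commute f x := by
  obtain ⟨R, hR⟩ := h.exists_zpow_mul_le htf hx hx1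
  choose k hk using fun n : ℕ => hR ((f * x * f⁻¹) ^ n) (hf.pow_left n)
  -- Pigeonhole in a finite ball: some nontrivial power of the conjugate is a power of `x`.
  obtain ⟨m, n, hmn, he⟩ := Set.Finite.exists_lt_map_eq_of_forall_mem
    (t := {g | ℓ g ≤ R}) (f := fun n => x ^ k n * (f * x * f⁻¹) ^ n) hk (h.finite_ball R)
  have he' : (f * x * f⁻¹) ^ ((n : ℤ) - m) = x ^ (k m - k n) := by
    have e : x ^ k m * (f * x * f⁻¹) ^ m = x ^ k n * (f * x * f⁻¹) ^ n := he
    rw [sub_eq_add_neg, sub_eq_neg_add, zpow_add, zpow_add, zpow_neg, zpow_neg, zpow_natCast,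
      zpow_natCast, eq_inv_mul_iff_mul_eq, ← mul_assoc, ← e, mul_inv_cancel_right]
  rw [conj_zpow] at he'
  refine h.commute_of_conj_zpow htf hx hx1 (fun h0 => ?_) he'
  rw [h0, zpow_zero, mul_inv_eq_one, mul_eq_left] at he'
  exact hx1 (htf.zpow_eq_one (by omega) he')

/-- A large cancellation would make the powers of `x` run alongside the points `f * z ^ j` for a
long time. Some offset between the two would then repeat, conjugating a power of `z` to a nontrivial
power of `x`. -/
theorem exists_forall_length_add_le_nat {x z f : G} {C : ℤ} (hx : IsAxial ℓ x C)
    (hz : IsAxial ℓ z C) (hf : ∀ a b : ℤ, a ≠ 0 → f * z ^ b * f⁻¹ ≠ x ^ a) :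
    ∃ K : ℤ, ∀ k l : ℕ, ℓ (x ^ k) + ℓ (z ^ l) ≤ ℓ ((x ^ k)⁻¹ * f * z ^ l) + K := by
  have hδ := h.const_nonneg
  have hC : 0 ≤ C := by simpa [h.one] using hx 0 0
  have hfin := h.finite_ball (C + (2 * ℓ f + C + δ) + ℓ z + δ)
  set I := hfin.toFinset.card
  have hxI : ∀ i ≤ I, ℓ (x ^ i) ≤ I * ℓ x := fun i hi =>
    (h.length_pow_le x i).trans (mul_le_mul_of_nonneg_right (mod_cast hi) (h.nonneg x))
  -- Large enough that the first `I + 1` powers of `x` all lie in the overlap, one more than the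
  -- number `I` of possible offsets.
  refine ⟨2 * (I * ℓ x) + ℓ f, fun k l => ?_⟩
  by_contra! hlt
  have hq1 := h.mul_le f (z ^ l)
  have hq2 := h.mul_le f⁻¹ (f * z ^ l)
  rw [inv_mul_cancel_left, h.inv] at hq2
  have hkI : I ≤ k := by
    by_contra! hk
    have h1 := hxI k hk.le
    have h2 := h.mul_le (x ^ k) ((x ^ k)⁻¹ * f * z ^ l)
    rw [mul_assoc, mul_inv_cancel_left] at h2
    rw [mul_assoc] at hlt
    omega
  have hnear : ∀ i ≤ I, ∃ j : ℕ, (z ^ j)⁻¹ * (f⁻¹ * x ^ i) ∈ hfin.toFinset := by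
    intro i hi
    have h1 := hxI i hi
    have h4 := h.four_point (x ^ i) (f * z ^ l) 1 (x ^ k)
    have h5 := hx i (k - i)
    rw [Nat.add_sub_cancel' (by omega)] at h5
    have e1 : (x ^ i)⁻¹ * x ^ k = x ^ (k - i) := by
      rw [inv_mul_eq_iff_eq_mul, ← pow_add, Nat.add_sub_cancel' (by omega)]
    rw [e1, mul_one, mul_one, h.inv, h.inv (f * z ^ l), inv_one, one_mul,
      h.dist_comm (f * z ^ l) (x ^ k), ← mul_assoc, ← mul_assoc] at h4
    have h6 := h.mul_le f⁻¹ (x ^ i)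
    rw [h.inv] at h6
    obtain ⟨j, -, hj⟩ := h.exists_pow_near hz (t := f⁻¹ * x ^ i) (l := l) (b := 2 * ℓ f + C + δ)
      (by rw [show (f⁻¹ * x ^ i)⁻¹ * z ^ l = (x ^ i)⁻¹ * f * z ^ l by group]; omega)
    exact ⟨j, by simpa using hj⟩
  choose! j hj using hnear
  obtain ⟨i, hi, i', hi', hne, he⟩ := Finset.exists_ne_map_eq_of_card_lt_of_maps_to
    (s := Finset.range (I + 1)) (t := hfin.toFinset) (by simp [I])
    (f := fun i => (z ^ j i)⁻¹ * (f⁻¹ * x ^ i)) fun i hi => hj i (by simpa [Nat.lt_succ_iff] using hi)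
  refine hf ((i' : ℤ) - i) ((j i' : ℤ) - j i) (by omega) ?_
  have he' : (z ^ j i)⁻¹ * (f⁻¹ * x ^ i) = (z ^ j i')⁻¹ * (f⁻¹ * x ^ i') := he
  rw [sub_eq_add_neg, sub_eq_add_neg, zpow_add, zpow_add, zpow_neg, zpow_neg]
  simp only [zpow_natCast]
  calc f * (z ^ j i' * (z ^ j i)⁻¹) * f⁻¹
      = f * z ^ j i' * ((z ^ j i)⁻¹ * (f⁻¹ * x ^ i)) * (x ^ i)⁻¹ := by group
    _ = x ^ i' * (x ^ i)⁻¹ := by rw [he']; group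

/-- The axis of an axial element `x` and its translate by an element not commuting with `x` have
bounded overlap. -/
theorem exists_forall_length_add_le_zpow (htf : IsTorsionFreeGroup G) {x f : G} {C : ℤ}
    (hx : IsAxial ℓ x C) (hx1 : x ≠ 1) (hf : ¬ Commute f x) :
    ∃ K : ℤ, ∀ k l : ℤ, ℓ (x ^ k) + ℓ (x ^ l) ≤ ℓ ((x ^ k)⁻¹ * f * x ^ l) + K := by
  have hx' := h.isAxial_inv hx
  have key : ∀ a b : ℤ, a ≠ 0 → f * x ^ b * f⁻¹ ≠ x ^ a := fun a b ha he =>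
    hf (h.commute_of_conj_zpow htf hx hx1 ha he)
  obtain ⟨K₁, h₁⟩ := h.exists_forall_length_add_le_nat hx hx key
  obtain ⟨K₂, h₂⟩ := h.exists_forall_length_add_le_nat (f := f) hx hx' fun a b ha => by
    rw [inv_zpow']; exact key a (-b) ha
  obtain ⟨K₃, h₃⟩ := h.exists_forall_length_add_le_nat (f := f) hx' hx fun a b ha => by
    rw [inv_zpow']; exact key (-a) b (neg_ne_zero.2 ha)
  obtain ⟨K₄, h₄⟩ := h.exists_forall_length_add_le_nat (f := f) hx' hx' fun a b ha => by
    rw [inv_zpow', inv_zpow']; exact key (-a) (-b) (neg_ne_zero.2 ha)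
  refine ⟨max (max K₁ K₂) (max K₃ K₄), fun k l => ?_⟩
  obtain ⟨m, rfl | rfl⟩ := k.eq_nat_or_neg <;> obtain ⟨n, rfl | rfl⟩ := l.eq_nat_or_neg
  · have := h₁ m n
    simp only [zpow_natCast]
    omega
  · have := h₂ m n
    simp only [inv_pow] at this
    simp only [zpow_neg, zpow_natCast]
    omega
  · have := h₃ m n
    simp only [inv_pow] at this
    simp only [zpow_neg, zpow_natCast]
    omega
  · have := h₄ m n
    simp only [inv_pow] at this
    simp only [zpow_neg, zpow_natCast]
    omega

end

end IsHyperbolicLength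

/-! ### Elements generating their own centralizer. -/

namespace IsHyperbolicLength

variable {G : Type*} [Group G] {ℓ : G → ℤ} {δ : ℤ}

section

variable (h : IsHyperbolicLength ℓ δ)
include h

/-- Modulo `w`, an element of the centralizer of an axial element `w` is close to a geodesic from
`1` to `w`. -/
theorem exists_commute_length_add_le (htf : IsTorsionFreeGroup G) {w : G} {C : ℤ}
    (hw : IsAxial ℓ w C) (hwC : C + δ < ℓ w) {t : G} (ht : Commute t w) :
    ∃ s, Commute s w ∧ ℓ s + ℓ (s⁻¹ * w) ≤ ℓ w + C + 4 * δ ∧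
      (s ∈ Subgroup.zpowers w → t ∈ Subgroup.zpowers w) := by
  have hδ := h.const_nonneg
  have hC : 0 ≤ C := by simpa [h.one] using hw 0 0
  have hw1 : w ≠ 1 := by
    rintro rfl
    rw [h.one] at hwC
    omega
  -- A shortest representative modulo `w` is no farther from `1` than from `w`, so if it is near a
  -- geodesic to `w ^ (M + 1)`, it is already near one to `w`.
  have key : ∀ s : G, Commute s w → (∀ m : ℤ, ℓ s ≤ ℓ (w ^ m * s)) → ∀ M : ℕ,
      ℓ s + ℓ (s⁻¹ * w ^ (M + 1)) ≤ ℓ (w ^ (M + 1)) + C + 3 * δ →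
      ℓ s + ℓ (s⁻¹ * w) ≤ ℓ w + C + 4 * δ := by
    intro s hs hmin M hM
    have h1 := h.four_point s w 1 (w ^ (M + 1))
    have h2 := hmin (-1)
    have h3 := hw 1 M
    rw [add_comm 1 M, pow_one] at h3
    rw [zpow_neg_one, h.dist_comm] at h2
    rw [show w⁻¹ * w ^ (M + 1) = w ^ M by rw [pow_succ', inv_mul_cancel_left], mul_one, mul_one,
      inv_one, one_mul, h.inv, h.inv] at h1
    omega
  let F : ℤ → ℕ := fun m => (ℓ (w ^ m * t)).toNat
  set m₀ := Function.argmin F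
  set s := w ^ m₀ * t with hs_def
  have hs : Commute s w := ((Commute.refl w).zpow_left m₀).mul_left ht
  have hmin : ∀ m : ℤ, ℓ s ≤ ℓ (w ^ m * s) := by
    intro m
    have h1 : F m₀ ≤ F (m + m₀) := Function.argmin_le F _
    have h2 := h.nonneg (w ^ (m + m₀) * t)
    rw [hs_def, ← mul_assoc, ← zpow_add]
    simp only [F] at h1
    omega
  have hst : s ∈ Subgroup.zpowers w → t ∈ Subgroup.zpowers w := fun hmem => by
    rwa [hs_def, Subgroup.mul_mem_cancel_left _ (Subgroup.zpow_mem_zpowers w m₀)] at hmem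
  obtain ⟨N, hN⟩ := h.exists_forall_length_add_le htf hw hw1 hs
  have h1 := hN (N + 1) (by omega)
  have h2 := h.four_point s 1 (w ^ (N + 1)) (w ^ (N + 1))⁻¹
  rw [show s⁻¹ * (w ^ (N + 1))⁻¹ = (w ^ (N + 1) * s)⁻¹ by group,
    show (w ^ (N + 1))⁻¹ * (w ^ (N + 1))⁻¹ = (w ^ (2 * (N + 1)))⁻¹ by
      rw [two_mul (N + 1), pow_add w (N + 1) (N + 1), mul_inv_rev], mul_one, inv_one, one_mul, one_mul, h.inv, h.inv, h.inv,
      h.inv] at h2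
  by_cases hcase : ℓ s + ℓ (s⁻¹ * w ^ (N + 1)) ≤ ℓ (w ^ (N + 1)) + C + 3 * δ
  · exact ⟨s, hs, key s hs hmin N hcase, hst⟩
  -- Otherwise `s` lies near the negative half of the axis, and `s⁻¹`, equally short modulo `w`,
  -- lies near the positive half.
  · have e : ∀ m : ℤ, ℓ (w ^ m * s⁻¹) = ℓ (w ^ (-m) * s) := fun m => by
      rw [← h.inv, mul_inv_rev, inv_inv, ← zpow_neg, (hs.zpow_right (-m)).eq]
    refine ⟨s⁻¹, hs.inv_left, key s⁻¹ hs.inv_left (fun m => ?_) N ?_,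
      fun hmem => hst (inv_mem_iff.1 hmem)⟩
    · rw [e, h.inv]; exact hmin _
    · rw [inv_inv, (hs.pow_right (N + 1)).eq, h.inv]
      omega

/-- Modulo `w = x ^ n * y`, a centralizing element becomes `s = x ^ i * c` with `i ≤ n` and `c` in a
ball independent of `n`. If `y * c⁻¹` commutes with `x`, transitivity forces `s = w`. If not,
bounded overlap forces `i`, hence `s`, to be small, and for large `n` only `s = 1` is left. -/
theorem exists_centralizer_le_zpowers_aux (htf : IsTorsionFreeGroup G) {x y : G} {C : ℤ}
    (hx : IsAxial ℓ x C) (hx1 : x ≠ 1) (hy : ¬ Commute y x) :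
    ∃ n : ℕ, ∀ t, Commute t (x ^ n * y) → t ∈ Subgroup.zpowers (x ^ n * y) := by
  have hδ := h.const_nonneg
  have hxy : ∀ k : ℕ, k ≠ 0 → ∀ s : G, Commute s (x ^ k) → Commute s x := fun k hk s hs =>
    h.commute_trans htf (fun hc => hx1 (htf.pow_eq_one hk hc)) hs ((Commute.refl x).pow_right k)
  obtain ⟨K₀, hK₀⟩ := h.exists_forall_length_add_le_zpow htf hx hx1 hy
  -- Bounds the defect `2 * ℓ w - ℓ (w ^ 2)` uniformly in `n`, so that all later radii can be fixed
  -- before `n`.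
  set β := K₀ + 3 * ℓ y with hβ
  set R := C + (β + 6 * δ + 2 * ℓ y) + ℓ x + δ
  have hK : ∀ c : G, ¬ Commute (y * c⁻¹) x → ∃ K : ℤ, ∀ k l : ℤ,
      ℓ (x ^ k) + ℓ (x ^ l) ≤ ℓ ((x ^ k)⁻¹ * (y * c⁻¹) * x ^ l) + K := fun c hc =>
    h.exists_forall_length_add_le_zpow htf hx hx1 hc
  choose! K hK using hK
  obtain ⟨K₁, hK₁⟩ := ((h.finite_ball R).image K).bddAbove
  obtain ⟨N₁, hN₁⟩ := h.exists_forall_lt_pow htf hx1 (C + R + ℓ y + K₁)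
  set R₂ := N₁ * ℓ x + R
  -- A nontrivial `s` commutes with `x ^ n * y` for at most one `n`: two exponents would make it
  -- commute with `x` and `y`, hence `x` with `y`.
  have hbad : (⋃ s ∈ {s : G | ℓ s ≤ R₂}, {n : ℕ | s ≠ 1 ∧ Commute s (x ^ n * y)}).Finite := by
    refine (h.finite_ball R₂).biUnion fun s _ => Set.Subsingleton.finite ?_
    have aux : ∀ n m : ℕ, s ≠ 1 → Commute s (x ^ n * y) → Commute s (x ^ m * y) → ¬ n < m := by
      intro n m hs hn hm hlt
      obtain ⟨k, rfl⟩ := Nat.exists_eq_add_of_lt hlt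
      have e : x ^ (n + k + 1) * y * (x ^ n * y)⁻¹ = x ^ (k + 1) := by
        rw [show n + k + 1 = (k + 1) + n by ring, pow_add]; group
      have hsx : Commute s x := hxy (k + 1) (by omega) s (e ▸ hm.mul_right hn.inv_right)
      have hsy : Commute s y := by
        have := (hsx.pow_right n).inv_right.mul_right hn
        rwa [inv_mul_cancel_left] at this
      exact hy (h.commute_trans htf hs hsy.symm hsx.symm)
    intro n hn m hm
    have h1 := aux n m hn.1 hn.2 hm.2
    have h2 := aux m n hn.1 hm.2 hn.2
    omega
  obtain ⟨N₂, hN₂⟩ := hbad.bddAbove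
  obtain ⟨N₀, hN₀⟩ := h.exists_forall_lt_pow htf hx1 (β + 3 * δ + ℓ y)
  set n := max N₀ (N₂ + 1)
  have hn₂ : ∀ s, ℓ s ≤ R₂ → Commute s (x ^ n * y) → s = 1 := by
    intro s hs hc
    by_contra hs1
    have : n ≤ N₂ := hN₂ (Set.mem_biUnion (show s ∈ {s : G | ℓ s ≤ R₂} from hs) ⟨hs1, hc⟩)
    omega
  have hn₀ := hN₀ n (le_max_left _ _)
  refine ⟨n, ?_⟩
  set w := x ^ n * y with hw_def
  have hwle : ℓ w ≤ ℓ (x ^ n) + ℓ y := h.mul_le _ _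
  have hwge : ℓ (x ^ n) ≤ ℓ w + ℓ y := by
    have := h.mul_le w y⁻¹
    rwa [hw_def, mul_inv_cancel_right, h.inv, ← hw_def] at this
  have hw2 : 2 * ℓ w ≤ ℓ (w ^ 2) + β := by
    have h1 := hK₀ (-n) n
    rw [zpow_neg, inv_inv, zpow_natCast, h.inv] at h1
    have h2 := h.mul_le (w ^ 2) y⁻¹
    rw [show w ^ 2 * y⁻¹ = x ^ n * y * x ^ n by rw [hw_def, sq]; group, h.inv] at h2
    omega
  have hw : IsAxial ℓ w (β + 2 * δ) := h.isAxial_of_lt hw2 (by omega)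
  intro t ht
  obtain ⟨s, hs, hsw, hst⟩ := h.exists_commute_length_add_le htf hw (by omega) ht
  refine hst ?_
  have h1 := h.mul_le (s⁻¹ * w) y⁻¹
  rw [mul_assoc, hw_def, mul_inv_cancel_right, h.inv, ← hw_def] at h1
  obtain ⟨i, hin, hi⟩ := h.exists_pow_near hx (t := s) (l := n) (b := β + 6 * δ + 2 * ℓ y)
    (by omega)
  set c := (x ^ i)⁻¹ * s with hc_def
  have hs_eq : s = x ^ i * c := by rw [hc_def, mul_inv_cancel_left]
  have hpow : x ^ n = x ^ i * x ^ (n - i) := by rw [← pow_add, Nat.add_sub_cancel' hin]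
  have hu : s⁻¹ * w = c⁻¹ * x ^ (n - i) * y := by rw [hs_eq, hw_def, hpow]; group
  have huw : Commute (s⁻¹ * w) w := hs.inv_left.mul_left (Commute.refl w)
  by_cases hcx : Commute (y * c⁻¹) x
  · by_cases hu1 : s⁻¹ * w = 1
    · rw [inv_mul_eq_one.1 hu1]; exact Subgroup.mem_zpowers w
    · exfalso
      have e1 : y * (s⁻¹ * w) * y⁻¹ = y * c⁻¹ * x ^ (n - i) := by rw [hu]; group
      have e2 : y * w * y⁻¹ = y * x ^ n := by rw [hw_def]; group
      have h2 : Commute x (y * (s⁻¹ * w) * y⁻¹) := by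
        rw [e1]; exact (hcx.mul_left ((Commute.refl x).pow_left _)).symm
      have h3 : Commute (y * x ^ n) (y * (s⁻¹ * w) * y⁻¹) := by
        rw [← e2]; exact huw.symm.conj y
      have h4 := h.commute_trans htf (fun hc => hu1 (conj_eq_one_iff.1 hc)) h3 h2
      refine hy ?_
      have := h4.mul_left ((Commute.refl x).pow_left n).inv_left
      rwa [mul_inv_cancel_right] at this
  -- The relation `s⁻¹ * w = w * s⁻¹` writes one element both as `c⁻¹ * x ^ (n - i) * y`, of length
  -- about `ℓ (x ^ n) - ℓ (x ^ i)` at most, and as `x ^ n * (y * c⁻¹) * (x ^ i)⁻¹`, of length about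
  -- `ℓ (x ^ n) + ℓ (x ^ i)` at least.
  · have h2 := hK c hcx (-n) (-i)
    have h3 : K c ≤ K₁ := hK₁ ⟨c, hi, rfl⟩
    have e : x ^ n * (y * c⁻¹) * (x ^ i)⁻¹ = c⁻¹ * x ^ (n - i) * y := by
      rw [← hu, hs.inv_left.eq, mul_assoc, mul_assoc, ← mul_inv_rev, ← hs_eq, ← mul_assoc]
    simp only [zpow_neg, zpow_natCast, inv_inv, h.inv] at h2
    rw [e] at h2
    have h4 := h.mul_le (c⁻¹ * x ^ (n - i)) y
    have h5 := h.mul_le c⁻¹ (x ^ (n - i))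
    have h6 := hx i (n - i)
    have h7 := h.nonneg (x ^ i)
    rw [Nat.add_sub_cancel' hin] at h6
    rw [h.inv] at h5
    have hiN : i ≤ N₁ := by
      by_contra! hc
      have := hN₁ i hc.le
      omega
    have h8 := h.length_pow_le x i
    have h9 : (i : ℤ) * ℓ x ≤ N₁ * ℓ x :=
      mul_le_mul_of_nonneg_right (mod_cast hiN) (h.nonneg x)
    have h10 := h.mul_le (x ^ i) c
    rw [← hs_eq] at h10
    rw [hn₂ s (by omega) hs]
    exact one_mem _

/-- A nonabelian subgroup of a torsion-free hyperbolic group contains an element which generates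
its own centralizer in the whole group. -/
theorem exists_centralizer_le_zpowers (htf : IsTorsionFreeGroup G) {H : Subgroup G} {x y : G}
    (hx : x ∈ H) (hy : y ∈ H) (hxy : ¬ Commute y x) :
    ∃ w ∈ H, ∀ t, Commute t w → t ∈ Subgroup.zpowers w := by
  have hx1 : x ≠ 1 := fun hc => hxy (hc ▸ Commute.one_right y)
  obtain ⟨k, hk, C, hC⟩ := h.exists_isAxial_pow htf hx1
  have hxk : x ^ k ≠ 1 := fun hc => hx1 (htf.pow_eq_one hk hc)
  obtain ⟨n, hn⟩ := h.exists_centralizer_le_zpowers_aux htf hC hxk fun hc =>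
    hxy (h.commute_trans htf hxk hc ((Commute.refl x).pow_right k))
  exact ⟨_, mul_mem (pow_mem (pow_mem hx k) n) hy, hn⟩

/-- A torsion-free hyperbolic group with a nontrivial abelian normal subgroup is virtually
cyclic. -/
theorem finiteIndex_zpowers_of_forall_commute (htf : IsTorsionFreeGroup G) {H : Subgroup G}
    [H.Normal] (hH : ∀ x ∈ H, ∀ y ∈ H, Commute y x) {x : G} (hx : x ∈ H) (hx1 : x ≠ 1) :
    (Subgroup.zpowers x).FiniteIndex := by
  obtain ⟨k, hk, C, hC⟩ := h.exists_isAxial_pow htf hx1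
  have hxk : x ^ k ≠ 1 := fun hc => hx1 (htf.pow_eq_one hk hc)
  -- The conjugates of `x ^ k` stay in the abelian group `H`, so malnormality makes `x ^ k` central
  -- in `G`.
  have hcen : ∀ f, Commute f (x ^ k) := fun f =>
    h.commute_of_commute_conj htf hC hxk (hH _ (pow_mem hx k) _
      (Subgroup.Normal.conj_mem inferInstance _ (pow_mem hx k) f))
  obtain ⟨R, hR⟩ := h.exists_zpow_mul_le htf hC hxk
  have := (h.finite_ball R).to_subtype
  have : Finite (G ⧸ Subgroup.zpowers x) := by
    refine Finite.of_surjective (fun g : {g : G | ℓ g ≤ R} => (g.1 : G ⧸ Subgroup.zpowers x)) ?_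
    intro q
    obtain ⟨g, rfl⟩ := QuotientGroup.mk_surjective q
    obtain ⟨n, hn⟩ := hR g (hcen g)
    refine ⟨⟨(x ^ k) ^ n * g, hn⟩, QuotientGroup.eq.2 ?_⟩
    rw [mul_inv_rev, mul_assoc, ← ((hcen g).zpow_right n).inv_right.eq, inv_mul_cancel_left]
    exact inv_mem (zpow_mem (pow_mem (Subgroup.mem_zpowers x) k) n)
  exact Subgroup.finiteIndex_of_finite_quotient

end

end IsHyperbolicLength

/-! ### Conjugacy in the fibre product. -/

section FibreProduct

variable {G : Type*} [Group G] {N : Subgroup G} [N.Normal]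

theorem mem_fibreProduct {p : G × G} : p ∈ fibreProduct N ↔ p.1⁻¹ * p.2 ∈ N := by
  change (p.1 : G ⧸ N) = p.2 ↔ _
  exact QuotientGroup.eq

/-- If `N` contains an element whose centralizer lies in `N`, and the fibre product of `N` is
conjugacy separable, then `N` is closed in the profinite topology. -/
theorem mem_of_isConjugacySeparable_fibreProduct (hsep : IsConjugacySeparable (fibreProduct N))
    {w : G} (hw : w ∈ N) (hcent : ∀ t, Commute t w → t ∈ N) {g : G}
    (hg : ∀ K : Subgroup G, K.FiniteIndex → N ≤ K → g ∈ K) : g ∈ N := by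
  have hconj : ∀ k, k * w * k⁻¹ ∈ N := fun k => Subgroup.Normal.conj_mem inferInstance w hw k
  let ι : N →* fibreProduct N := ((MonoidHom.inr G G).comp N.subtype).codRestrict _ fun k =>
    mem_fibreProduct.2 (by simp)
  let Δ : G →* fibreProduct N := ((MonoidHom.id G).prod (MonoidHom.id G)).codRestrict _ fun k =>
    mem_fibreProduct.2 (by simp)
  let a : fibreProduct N := ⟨(w, 1), mem_fibreProduct.2 (by simpa using hw)⟩
  have hΔι : ∀ k, Δ k * ι ⟨w, hw⟩ * (Δ k)⁻¹ = ι ⟨k * w * k⁻¹, hconj k⟩ := fun k =>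
    Subtype.ext (Prod.ext (by simp [Δ, ι]) (by simp [Δ, ι]))
  by_contra hgN
  have hnot : ¬ IsConj (a * ι ⟨w, hw⟩) (a * ι ⟨g * w * g⁻¹, hconj g⟩) := by
    rw [isConj_iff]
    rintro ⟨c, hc⟩
    have h1 : (c : G × G).1 * w * (c : G × G).1⁻¹ = w := by
      simpa [a, ι] using congrArg (fun z : fibreProduct N => (z : G × G).1) hc
    have h2 : (c : G × G).2 * w * (c : G × G).2⁻¹ = g * w * g⁻¹ := by
      simpa [a, ι] using congrArg (fun z : fibreProduct N => (z : G × G).2) hc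
    have h3 := hcent _ (mul_inv_eq_iff_eq_mul.1 h1)
    have h4 : g⁻¹ * (c : G × G).2 ∈ N := hcent _ <| by
      change g⁻¹ * (c : G × G).2 * w = w * (g⁻¹ * (c : G × G).2)
      rw [mul_assoc, mul_inv_eq_iff_eq_mul.1 h2]
      group
    have h5 := mul_mem h3 (mem_fibreProduct.1 c.2)
    rw [mul_inv_cancel_left] at h5
    have h6 := mul_mem h5 (inv_mem h4)
    rw [mul_inv_rev, inv_inv, mul_inv_cancel_left] at h6
    exact hgN h6
  obtain ⟨Q, _, _, ψ, hψ⟩ := hsep _ _ hnot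
  -- To `ψ`, conjugating `(1, w)` by the diagonal image of an element of `K` is invisible. Writing
  -- `g = k * c` with `k ∈ N`, `c ∈ K`, the conjugator is `(1, k)`, which commutes with `a = (w,
  -- 1)`.
  let K : Subgroup G := (Subgroup.centralizer {ψ (ι ⟨w, hw⟩)}).comap (ψ.comp Δ)
  have hker : (ψ.comp Δ).ker ≤ K := fun k hk => by
    change ψ.comp Δ k ∈ Subgroup.centralizer {ψ (ι ⟨w, hw⟩)}
    rw [MonoidHom.mem_ker.1 hk]
    exact one_mem _
  have hK : (N ⊔ K).FiniteIndex :=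
    Subgroup.finiteIndex_of_le (hker.trans le_sup_right)
  obtain ⟨k, hk, c, hc, rfl⟩ := Subgroup.mem_sup_of_normal_left.1 (hg _ hK le_sup_left)
  have hcw : ψ (ι ⟨c * w * c⁻¹, hconj c⟩) = ψ (ι ⟨w, hw⟩) := by
    rw [← hΔι, map_mul, map_mul, map_inv, mul_inv_eq_iff_eq_mul]
    exact (Subgroup.mem_centralizer_iff.1 hc _ rfl).symm
  have hak : ι ⟨k, hk⟩ * a = a * ι ⟨k, hk⟩ :=
    Subtype.ext (Prod.ext (by simp [a, ι]) (by simp [a, ι]))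
  refine hψ (isConj_iff.2 ⟨ψ (ι ⟨k, hk⟩), ?_⟩)
  have e : (⟨k * c * w * (k * c)⁻¹, hconj (k * c)⟩ : N) =
      ⟨k, hk⟩ * ⟨c * w * c⁻¹, hconj c⟩ * ⟨k, hk⟩⁻¹ := Subtype.ext (by simp [mul_assoc])
  rw [e, map_mul ι, map_mul ι, map_inv ι, map_mul ψ a (ι _), map_mul ψ a (_ * _ * _),
    map_mul ψ (_ * _), map_mul ψ (ι _) (ι _), hcw, map_inv, ← mul_assoc, ← mul_assoc, ← mul_assoc,
    ← map_mul ψ, ← map_mul ψ, hak, map_mul ψ (a * _), map_mul ψ a]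

end FibreProduct

/-! ### The main theorem. -/

theorem corollary7p6 {G : Type*} [Group G] (hG : IsHyperbolicGroup G)
    (htf : IsTorsionFreeGroup G) (hrf : Group.ResiduallyFinite G)
    (H : Subgroup G) [H.Normal] (hH : H.FG)
    (hquot : ¬ Group.ResiduallyFinite (G ⧸ H)) :
    ¬ IsConjugacySeparable (fibreProduct H) := by
  intro hsep
  obtain ⟨ℓ, δ, h⟩ := hG.exists_isHyperbolicLength
  by_cases hab : ∀ x ∈ H, ∀ y ∈ H, Commute y x
  · have hbot : H ≠ ⊥ := by
      rintro rfl
      refine hquot (Group.residuallyFinite_iff_forall_finiteIndex.2 fun q hq => ?_)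
      refine (QuotientGroup.quotientBot (G := G)).map_eq_one_iff.1 ?_
      refine Group.residuallyFinite_iff_forall_finiteIndex.1 hrf _ fun K _ => ?_
      have : (K.comap (QuotientGroup.quotientBot (G := G)).toMonoidHom).FiniteIndex :=
        ⟨by rw [Subgroup.index_comap_of_surjective _
              (f := (QuotientGroup.quotientBot (G := G)).toMonoidHom)
              (QuotientGroup.quotientBot (G := G)).surjective]
            exact Subgroup.FiniteIndex.index_ne_zero⟩
      exact hq (K.comap (QuotientGroup.quotientBot (G := G)).toMonoidHom)
    obtain ⟨x, hx, hx1⟩ := H.bot_or_exists_ne_one.resolve_left hbot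
    have := h.finiteIndex_zpowers_of_forall_commute htf hab hx hx1
    have : H.FiniteIndex := Subgroup.finiteIndex_of_le (Subgroup.zpowers_le.2 hx)
    exact hquot inferInstance
  · push Not at hab
    obtain ⟨x, hx, y, hy, hxy⟩ := hab
    obtain ⟨w, hw, hcent⟩ := h.exists_centralizer_le_zpowers htf hx hy hxy
    rw [Group.residuallyFinite_iff_forall_finiteIndex] at hquot
    push Not at hquot
    obtain ⟨q, hq, hq1⟩ := hquot
    obtain ⟨g, rfl⟩ := QuotientGroup.mk_surjective q
    refine hq1 ((QuotientGroup.eq_one_iff g).2 ?_)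
    refine mem_of_isConjugacySeparable_fibreProduct hsep hw
      (fun t ht => Subgroup.zpowers_le.2 hw (hcent t ht)) fun K hK hHK => ?_
    have hmap : (K.map (QuotientGroup.mk' H)).FiniteIndex := by
      refine ⟨fun h0 => hK.index_ne_zero ?_⟩
      rwa [Subgroup.index_map_eq _ (QuotientGroup.mk'_surjective H) (by simpa using hHK)] at h0
    obtain ⟨k, hk, he⟩ := hq (K.map (QuotientGroup.mk' H))
    have := hHK (QuotientGroup.eq.1 he)
    rwa [K.mul_mem_cancel_left (inv_mem hk)] at this
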